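/- Let $V$ be a finite set. Consider integer-weighted graphs on $V$, directed or undirected (loops are possible edges), given by a weight function $c_G$ that assigns a non-negative integer to every possible edge; the edges of $G$ are the possible edges of positive weight, and in the undirected case $uv=vu$. The out- and in-strength of $u$ in a directed graph are $\sum_v c_G(uv)$ and $\sum_v c_G(vu)$; the strength of $u$ in an undirected graph is the sum of the weights of the edges at $u$, a loop being counted twice. Fix a graph $G_0$ and a set $\mathcal F$ of possible edges, and let $\mathcal G$ be the (finite) set of all graphs $G$ on $V$ with the same strength sequence (in the directed case: the same in- and out-strengths) as $G_0$ and with $c_G(uv)=c_{G_0}(uv)$ for all $uv\in\mathcal F$. Put $$N_G(u)=\{v: vu\in E(G),\ vu\notin\mathcal F\},\qquad M_G(u)=\{v: uv\notin\mathcal F\}.$$ *Sampling a vertex sequence at $G$.* Draw $W_0$ uniformly from $\{v: N_G(v)\ne\emptyset\}$. For $n=0,2,4,\dots$: draw $W_{n+1}$ uniformly from $N_G(W_n)\setminus\{W_{n-1}\}$ (from $N_G(W_0)$ if $n=0$); if $W_0\in M_G(W_{n+1})\setminus\{W_n\}$, stop with the sequence $W=W_0W_1\cdots W_{n+1}W_0$;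 otherwise draw $W_{n+2}$ uniformly from $M_G(W_{n+1})\setminus\{W_n\}$ and continue. If a set to draw from is empty, or if the procedure never stops, no sequence is obtained. For a sequence $w=w_0w_1\cdots w_kw_0$ let $z=\{w,w^r\}$, where $w^r$ is the reverse of $w$, let $\mathbb V_G(z)$ be the probability that the sequence obtained at $G$ is in $z$, and let $n_w(uv)$ be the number of occurrences of $uv$ among $w_1w_0,w_3w_2,\dots,w_kw_{k-1}$ minus the number of occurrences among $w_1w_2,w_3w_4,\dots,w_kw_0$. *One iteration of the Weighted Graph Sampler at $G$.* Sample a vertex sequence. If none is obtained, stay at $G$. If $w$ is obtained, let $G_\Delta$ be the graph with weights $c_G(uv)+n_w(uv)\Delta$, draw an integer $\Delta$ from those for which all these weights are non-negative, with probability proportional to $\mathbb V_{G_\Delta}(z)$, and move to $G_\Delta$ (if $n_w=0$, then $G_\Delta=G$ for all $\Delta$, and the chain stays at $G$). **Proposition.** Started in $\mathcal G$, the Markov chain whose steps are iterations of the Weighted Graph Sampler stays in $\mathcal G$; it is reversible and ergodic with respect to the uniform distribution on $\mathcal G$. That is, the uniform distribution satisfies detailed balance and is stationary, the chain is irreducible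 and aperiodic on $\mathcal G$, and from every initial graph in $\mathcal G$ its law converges in total variation to the uniform distribution on $\mathcal G$. -/

import Mathlib

open scoped ENNReal Topology

namespace WGS

noncomputable section

/-! ## Ergodicity of a Markov chain with countable state space -/

section MarkovChain

variable {X : Type*}

/-- The law after `n` steps of the chain with transition probabilities `P`, started at `x`. -/
def nStep (P : X → PMF X) : ℕ → X → PMF X
  | 0, x => PMF.pure x
  | n + 1, x => (nStep P n x).bind P

/-- Detailed balance. -/
def IsReversible (P : X → PMF X) (π : PMF X) : Prop :=
  ∀ x y, π x * P x y = π y * P y x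

/-- The chain with transition probabilities `P`, run on the set of states `S`, is ergodic with
respect to `π`: the chain stays in `S`, `π` is a stationary distribution carried by `S`, the chain
is irreducible and aperiodic on `S`, and from every starting state in `S` the law of the chain
converges to `π` in total variation. -/
structure IsErgodicOn (P : X → PMF X) (S : Set X) (π : PMF X) : Prop where
  stays : ∀ x ∈ S, (P x).support ⊆ S
  carried : π.support ⊆ S
  stationary : π.bind P = π
  irreducible : ∀ x ∈ S, ∀ y ∈ S, ∃ n, nStep P n x y ≠ 0
  aperiodic : ∀ x ∈ S, ∀ d : ℕ, (∀ n, 1 ≤ n → nStep P n x x ≠ 0 → d ∣ n) → d = 1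
  tendsto : ∀ x ∈ S, Filter.Tendsto
    (fun n => ∑' y, |(nStep P n x y).toReal - (π y).toReal|) Filter.atTop (𝓝 0)

end MarkovChain

/-! ## The sampler

`V` is the vertex set and `E` the set of possible edges, `e u v : E` being the possible edge `uv`.
For directed graphs `E = V × V` and `e u v = (u, v)`; for undirected graphs `E = Sym2 V` and
`e u v = s(u, v)`. An integer-weighted graph is given by its weight function `G : E → ℕ`; its edges
are the possible edges of positive weight. `F` is the set of fixed possible edges. -/

section Sampler

variable {V E : Type*} [Fintype V] (e : V → V → E) (F : Set E)

open Classical in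
/-- `N_G(u)`: the vertices `v` for which `vu` is an edge of `G` that is not fixed. -/
def nbrN (G : E → ℕ) (u : V) : Finset V :=
  Finset.univ.filter fun v => 0 < G (e v u) ∧ e v u ∉ F

open Classical in
/-- `M_G(u)`: the vertices `v` for which `uv` is not fixed. -/
def nbrM (u : V) : Finset V :=
  Finset.univ.filter fun v => e u v ∉ F

/-- States of the loop that samples the vertex sequence. -/
inductive WalkState (V : Type*) where
  /-- The loop is running; the arguments are `W₀`, `Wₙ₋₁` (`none` if `n = 0`), `Wₙ` and the list
  `[W₀, …, Wₙ]`. -/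
  | running (w₀ : V) (prev : Option V) (cur : V) (path : List V)
  /-- The loop has ended with the sequence `w = [W₀, …, Wₙ₊₁, W₀]`. -/
  | closed (w : List V)
  /-- A set to sample from was empty. -/
  | stuck

open Classical in
/-- Sampling of `W₀`, uniformly from the vertices `v` with `N_G(v) ≠ ∅`. -/
def walkStart (G : E → ℕ) : PMF (WalkState V) :=
  if h : (Finset.univ.filter fun v : V => (nbrN e F G v).Nonempty).Nonempty then
    (PMF.uniformOfFinset _ h).map fun v => .running v none v [v]
  else PMF.pure .stuck

open Classical in
/-- One pass through the loop: `Wₙ₊₁` is uniform on `N_G(Wₙ) \ {Wₙ₋₁}`; then `Wₙ₊₂ = W₀` if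
`W₀ ∈ M_G(Wₙ₊₁) \ {Wₙ}`, and otherwise `Wₙ₊₂` is uniform on `M_G(Wₙ₊₁) \ {Wₙ}`. -/
def walkStep (G : E → ℕ) : WalkState V → PMF (WalkState V)
  | .running w₀ prev cur path =>
    if hA : ((nbrN e F G cur).filter fun v => prev ≠ some v).Nonempty then
      (PMF.uniformOfFinset _ hA).bind fun x =>
        if w₀ ∈ (nbrM e F x).erase cur then PMF.pure (.closed (path ++ [x, w₀]))
        else if hB : ((nbrM e F x).erase cur).Nonempty then
          (PMF.uniformOfFinset _ hB).map fun y => .running w₀ (some x) y (path ++ [x, y])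
        else PMF.pure .stuck
    else PMF.pure .stuck
  | .closed w => PMF.pure (.closed w)
  | .stuck => PMF.pure .stuck

/-- The law of the state of the loop after `n` passes. -/
def walk (G : E → ℕ) : ℕ → PMF (WalkState V)
  | 0 => walkStart e F G
  | n + 1 => (walk G n).bind (walkStep e F G)

/-- The probability that the loop ends with the sequence `w` (the probabilities that it has done so
within `n` passes increase with `n`). -/
def seqProb (G : E → ℕ) (w : List V) : ℝ≥0∞ := ⨆ n, walk e F G n (.closed w)

theorem walk_closed_mono (G : E → ℕ) (w : List V) :
    Monotone fun n => walk e F G n (.closed w) := by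
  refine monotone_nat_of_le_succ fun n => ?_
  show _ ≤ ((walk e F G n).bind (walkStep e F G)) (.closed w)
  rw [PMF.bind_apply]
  refine le_trans ?_ (ENNReal.le_tsum (WalkState.closed w))
  simp [walkStep]

theorem tsum_seqProb_le_one (G : E → ℕ) : ∑' w, seqProb e F G w ≤ 1 := by
  rw [ENNReal.tsum_eq_iSup_sum]
  refine iSup_le fun s => ?_
  unfold seqProb
  rw [ENNReal.finsetSum_iSup_of_monotone fun w => walk_closed_mono e F G w]
  refine iSup_le fun n => ?_
  calc ∑ w ∈ s, walk e F G n (.closed w)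
      ≤ ∑' w, walk e F G n (.closed w) := ENNReal.sum_le_tsum s
    _ ≤ ∑' t, walk e F G n t :=
        ENNReal.tsum_comp_le_tsum_of_injective (fun a b h => by simpa using h) _
    _ = 1 := (walk e F G n).tsum_coe

theorem hasSum_elim {α : Type*} (p : α → ℝ≥0∞) (h : ∑' a, p a ≤ 1) :
    HasSum (fun o : Option α => o.elim (1 - ∑' a, p a) p) 1 := by
  rw [ENNReal.summable.hasSum_iff, ENNReal.tsum_eq_add_tsum_ite none,
    ← Function.Injective.tsum_eq (Option.some_injective α)]
  · simpa using tsub_add_cancel_of_le h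
  · rintro (_ | a) ha
    · simp at ha
    · exact ⟨a, rfl⟩

/-- The law of the sampled vertex sequence. The value `none` collects the runs that yield no
sequence: those that return the identity kernel because a set to sample from is empty, and those
in which the loop never ends. -/
def seqLaw (G : E → ℕ) : PMF (Option (List V)) :=
  ⟨fun o => o.elim (1 - ∑' w, seqProb e F G w) (seqProb e F G),
    hasSum_elim _ (tsum_seqProb_le_one e F G)⟩

open Classical in
/-- `𝕍_G(z)` for the class `z = {w, wʳ}` of a vertex sequence `w` and its reverse. -/
def classProb (G : E → ℕ) (w : List V) : ℝ≥0∞ :=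
  ∑ w' ∈ ({w, w.reverse} : Finset (List V)), seqProb e F G w'

open Classical in
/-- `n_w(x)` for `w = [w₀, w₁, …, w_k, w₀]`: the number of occurrences of `x` among `w₁w₀`, `w₃w₂`,
…, `w_kw_{k-1}` minus the number of occurrences among `w₁w₂`, `w₃w₄`, …, `w_kw₀`. -/
def visits : List V → E → ℤ
  | a :: b :: c :: l, x =>
    (if e b a = x then 1 else 0) - (if e b c = x then 1 else 0) + visits (c :: l) x
  | _, _ => 0

/-- The admissible values of `Δ`: no weight becomes negative. -/
def Admissible (G : E → ℕ) (w : List V) (Δ : ℤ) : Prop :=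
  ∀ x, 0 ≤ (G x : ℤ) + visits e w x * Δ

/-- The graph `G_Δ` with weights `c_G(x) + n_w(x) Δ`. -/
def shift (G : E → ℕ) (w : List V) (Δ : ℤ) : E → ℕ :=
  fun x => ((G x : ℤ) + visits e w x * Δ).toNat

open Classical in
/-- The weight `𝕍_{G_Δ}(z)` of an admissible `Δ`, where `z` is the class of `w`. -/
def deltaWeight (G : E → ℕ) (w : List V) (Δ : ℤ) : ℝ≥0∞ :=
  if Admissible e G w Δ then classProb e F (shift e G w Δ) w else 0

open Classical in
/-- The law of `Δ`: proportional to `𝕍_{G_Δ}(z)` on the admissible range. For a sequence `w` that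
can be sampled at `G`, the weights have an infinite sum only if `n_w = 0`; every `Δ` then gives the
graph `G`, and `Δ = 0` is taken. -/
def deltaLaw (G : E → ℕ) (w : List V) : PMF ℤ :=
  if h : ∑' Δ, deltaWeight e F G w Δ ≠ 0 ∧ ∑' Δ, deltaWeight e F G w Δ ≠ ∞ then
    PMF.normalize (deltaWeight e F G w) h.1 h.2
  else PMF.pure 0

/-- One iteration of the weighted graph sampler. -/
def sampler (G : E → ℕ) : PMF (E → ℕ) :=
  (seqLaw e F G).bind fun o =>
    match o with
    | none => PMF.pure G
    | some w => (deltaLaw e F G w).map (shift e G w)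

end Sampler

/-! ## The state spaces -/

section StateSpaces

variable {V : Type*} [Fintype V]

/-- Out-strength of a vertex of a directed graph. -/
def outStrength (G : V × V → ℕ) (u : V) : ℕ := ∑ v, G (u, v)

/-- In-strength of a vertex of a directed graph. -/
def inStrength (G : V × V → ℕ) (u : V) : ℕ := ∑ v, G (v, u)

/-- Strength of a vertex of an undirected graph; a loop has both of its ends at its vertex, so that
its weight counts twice. -/
def strength (G : Sym2 V → ℕ) (u : V) : ℕ := (∑ v, G s(u, v)) + G s(u, u)

/-- The directed graphs with the strength sequences of `G₀` and the weights of `G₀` on `F`. -/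
def directedGraphs (G₀ : V × V → ℕ) (F : Set (V × V)) : Set (V × V → ℕ) :=
  {G | (∀ u, outStrength G u = outStrength G₀ u) ∧ (∀ u, inStrength G u = inStrength G₀ u) ∧
    ∀ x ∈ F, G x = G₀ x}

/-- The undirected graphs with the strength sequence of `G₀` and the weights of `G₀` on `F`. -/
def undirectedGraphs (G₀ : Sym2 V → ℕ) (F : Set (Sym2 V)) : Set (Sym2 V → ℕ) :=
  {G | (∀ u, strength G u = strength G₀ u) ∧ ∀ x ∈ F, G x = G₀ x}

theorem finite_directedGraphs (G₀ : V × V → ℕ) (F : Set (V × V)) :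
    (directedGraphs G₀ F).Finite := by
  refine (Set.Finite.pi' (t := fun x : V × V => Set.Iic (outStrength G₀ x.1))
    fun x => Set.finite_Iic _).subset ?_
  rintro G ⟨h, -, -⟩ ⟨u, v⟩
  rw [Set.mem_Iic, ← h u]
  exact Finset.single_le_sum (f := fun v => G (u, v)) (fun _ _ => Nat.zero_le _)
    (Finset.mem_univ v)

theorem finite_undirectedGraphs (G₀ : Sym2 V → ℕ) (F : Set (Sym2 V)) :
    (undirectedGraphs G₀ F).Finite := by
  refine (Set.Finite.pi' (t := fun _ : Sym2 V => Set.Iic (∑ u, strength G₀ u))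
    fun x => Set.finite_Iic _).subset ?_
  rintro G ⟨h, -⟩ x
  induction x using Sym2.ind with
  | _ u v =>
    rw [Set.mem_Iic]
    calc G s(u, v) ≤ ∑ v, G s(u, v) :=
          Finset.single_le_sum (f := fun v => G s(u, v)) (fun _ _ => Nat.zero_le _)
            (Finset.mem_univ v)
      _ ≤ strength G u := Nat.le_add_right _ _
      _ = strength G₀ u := h u
      _ ≤ ∑ u, strength G₀ u :=
          Finset.single_le_sum (f := fun u => strength G₀ u) (fun _ _ => Nat.zero_le _)
            (Finset.mem_univ u)

/-- The uniform distribution on `directedGraphs G₀ F`. -/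
def directedUniform (G₀ : V × V → ℕ) (F : Set (V × V)) : PMF (V × V → ℕ) :=
  PMF.uniformOfFinset (finite_directedGraphs G₀ F).toFinset
    ⟨G₀, by simp [directedGraphs]⟩

/-- The uniform distribution on `undirectedGraphs G₀ F`. -/
def undirectedUniform (G₀ : Sym2 V → ℕ) (F : Set (Sym2 V)) : PMF (Sym2 V → ℕ) :=
  PMF.uniformOfFinset (finite_undirectedGraphs G₀ F).toFinset
    ⟨G₀, by simp [undirectedGraphs]⟩

end StateSpaces

end

end WGS

/-! Uniform stationarity comes from symmetry of the kernel. A sequence `w` determines the line of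
graphs `G + Δ n_w`. For `G ≠ G'` on this line, the move by `w` has probability `𝕍_{G'}(z)/T` once
`w` is drawn, where `T` is the sum of the class weights along the line. Moving the base point
translates `Δ`, and reversing `w` negates it, so `T` and the weights depend only on the line and the
class. Adding the contributions of `w` and its reverse turns the probability of drawing `w` into
`𝕍_G(z)`, up to a factor for palindromes, and leaves sums of the symmetric terms `𝕍_G(z)
𝕍_{G'}(z)/T` (`sampler_comm`). The value `Δ = 0` always has positive probability, so every state has
a loop (`sampler_self_ne_zero`).

For irreducibility, let `G ≠ H` lie in the state space and follow `D₀ = G - H`: alternately remove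
an edge where `G` has excess and add one where it has a deficit. Equality of strengths always
supplies the next edge (`Trail.exists_step`), and the remaining difference shrinks until the loop
closes. The closing edge may be a wrong one, but it costs at most 1, which the last removal repays,
and the earlier steps have made a strict gain. So `Δ = -1` leads strictly closer to `H`
(`Incidence.exists_closer`). This move has positive weight because the reverse of `w` can be sampled
at the new graph (`Run.closed_reverse`).

A finite irreducible chain with loops has a power with all entries positive, which contracts the
`ℓ¹` distance (`isErgodicOn_of_loop`). -/

namespace WGS

/-! ## Convergence of finite Markov chains -/

section Markov

variable {X : Type*} {P : X → PMF X} {S : Finset X} {π : PMF X}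

theorem nStep_one (P : X → PMF X) (x : X) : nStep P 1 x = P x := by
  simp [nStep, PMF.pure_bind]

theorem nStep_add (P : X → PMF X) (m n : ℕ) (x : X) :
    nStep P (m + n) x = (nStep P m x).bind (nStep P n) := by
  induction n with
  | zero => exact (PMF.bind_pure _).symm
  | succ n ih =>
    change (nStep P (m + n) x).bind P = (nStep P m x).bind fun z => (nStep P n z).bind P
    rw [ih, PMF.bind_bind]

theorem nStep_add_ne_zero {m n : ℕ} {x y z : X} (h₁ : nStep P m x y ≠ 0)
    (h₂ : nStep P n y z ≠ 0) : nStep P (m + n) x z ≠ 0 := by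
  rw [nStep_add, ← PMF.mem_support_iff, PMF.mem_support_bind_iff]
  exact ⟨y, h₁, h₂⟩

theorem support_nStep_subset (stays : ∀ x ∈ S, (P x).support ⊆ S) (n : ℕ) {x : X} (hx : x ∈ S) :
    (nStep P n x).support ⊆ S := by
  induction n with
  | zero => simpa [nStep] using hx
  | succ n ih =>
    intro y hy
    obtain ⟨z, hz, hzy⟩ := (PMF.mem_support_bind_iff _ _ _).1 hy
    exact stays z (ih hz) hzy

theorem bind_nStep (stationary : π.bind P = π) (n : ℕ) : π.bind (nStep P n) = π := by
  induction n with
  | zero => exact PMF.bind_pure _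
  | succ n ih =>
    change π.bind (fun x => (nStep P n x).bind P) = π
    rw [← PMF.bind_bind, ih, stationary]

theorem sum_toReal_eq_one {p : PMF X} (hp : p.support ⊆ S) : ∑ x ∈ S, (p x).toReal = 1 := by
  rw [← ENNReal.toReal_sum fun x _ => p.apply_ne_top x, ← ENNReal.toReal_one, ← p.tsum_coe,
    tsum_eq_sum fun x hx => ?_]
  by_contra h
  exact hx (hp h)

theorem bind_apply_toReal {p : PMF X} (hp : p.support ⊆ S) (Q : X → PMF X) (y : X) :
    (p.bind Q y).toReal = ∑ x ∈ S, (p x).toReal * (Q x y).toReal := by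
  rw [PMF.bind_apply, tsum_eq_sum (s := S) fun x hx => ?_, ENNReal.toReal_sum fun x _ => ?_]
  · simp
  · exact ENNReal.mul_ne_top (p.apply_ne_top x) ((Q x).apply_ne_top y)
  · have : p x = 0 := by
      by_contra h
      exact hx (hp h)
    simp [this]

/-- A transition kernel on a finite set all of whose entries are at least `ε` contracts the `ℓ¹`
distance by the factor `1 - ε`. -/
theorem sum_abs_bind_sub_le {Q : X → PMF X} (hQ : ∀ x ∈ S, (Q x).support ⊆ S) {ε : ℝ}
    (hε : 0 ≤ ε) (hQε : ∀ x ∈ S, ∀ y ∈ S, ε ≤ (Q x y).toReal) {p q : PMF X}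
    (hp : p.support ⊆ S) (hq : q.support ⊆ S) :
    ∑ y ∈ S, |(p.bind Q y).toReal - (q.bind Q y).toReal| ≤
      (1 - ε) * ∑ x ∈ S, |(p x).toReal - (q x).toReal| := by
  have hS : (1 : ℝ) ≤ S.card := by
    obtain ⟨x, hx⟩ := p.support_nonempty
    exact_mod_cast Finset.card_pos.2 ⟨x, hp hx⟩
  -- Subtracting `ε` from every entry changes nothing, since `p` and `q` have the same total mass;
  -- the entries stay non-negative.
  have key (y : X) : (p.bind Q y).toReal - (q.bind Q y).toReal =
      ∑ x ∈ S, ((p x).toReal - (q x).toReal) * ((Q x y).toReal - ε) := by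
    simp only [bind_apply_toReal hp, bind_apply_toReal hq, sub_mul, mul_sub,
      Finset.sum_sub_distrib, ← Finset.sum_mul, sum_toReal_eq_one hp, sum_toReal_eq_one hq]
    ring
  calc ∑ y ∈ S, |(p.bind Q y).toReal - (q.bind Q y).toReal|
      ≤ ∑ y ∈ S, ∑ x ∈ S, |(p x).toReal - (q x).toReal| * ((Q x y).toReal - ε) := by
        refine Finset.sum_le_sum fun y hy => ?_
        rw [key]
        refine (Finset.abs_sum_le_sum_abs _ _).trans (Finset.sum_le_sum fun x hx => ?_)
        rw [abs_mul, abs_of_nonneg (sub_nonneg.2 (hQε x hx y hy))]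
    _ = ∑ x ∈ S, |(p x).toReal - (q x).toReal| * (1 - S.card * ε) := by
        rw [Finset.sum_comm]
        refine Finset.sum_congr rfl fun x hx => ?_
        rw [← Finset.mul_sum, Finset.sum_sub_distrib, sum_toReal_eq_one (hQ x hx)]
        simp
    _ ≤ (1 - ε) * ∑ x ∈ S, |(p x).toReal - (q x).toReal| := by
        rw [← Finset.sum_mul, mul_comm]
        refine mul_le_mul_of_nonneg_right ?_ (Finset.sum_nonneg fun _ _ => abs_nonneg _)
        nlinarith

theorem nStep_ne_zero_of_le (loop : ∀ x ∈ S, P x x ≠ 0) {m n : ℕ} (hmn : m ≤ n) {x y : X}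
    (hy : y ∈ S) (h : nStep P m x y ≠ 0) : nStep P n x y ≠ 0 := by
  induction n, hmn using Nat.le_induction with
  | base => exact h
  | succ n _ ih => exact nStep_add_ne_zero ih (by rw [nStep_one]; exact loop y hy)

/-- Loops make positivity persist as the number of steps grows, so the maximum of the finitely many
hitting times serves all pairs at once. -/
theorem exists_nStep_pos (loop : ∀ x ∈ S, P x x ≠ 0)
    (irreducible : ∀ x ∈ S, ∀ y ∈ S, ∃ n, nStep P n x y ≠ 0) :
    ∃ N, ∃ ε : ℝ, 0 < ε ∧ ∀ x ∈ S, ∀ y ∈ S, ε ≤ (nStep P N x y).toReal := by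
  choose! n hn using irreducible
  let N := S.sup fun x => S.sup fun y => n x y
  have hN : ∀ x ∈ S, ∀ y ∈ S, nStep P N x y ≠ 0 := fun x hx y hy =>
    nStep_ne_zero_of_le loop
      ((Finset.le_sup (f := fun y => n x y) hy).trans
        (Finset.le_sup (f := fun x => S.sup fun y => n x y) hx)) hy (hn x hx y hy)
  rcases (S ×ˢ S).eq_empty_or_nonempty with h | h
  · refine ⟨N, 1, one_pos, fun x hx y hy => ?_⟩
    have := Finset.mk_mem_product hx hy
    simp [h] at this
  · obtain ⟨a, ha, hmin⟩ := (S ×ˢ S).exists_min_image (fun a => (nStep P N a.1 a.2).toReal) h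
    refine ⟨N, (nStep P N a.1 a.2).toReal, ?_, fun x hx y hy => hmin (x, y) (by simp [hx, hy])⟩
    rw [Finset.mem_product] at ha
    exact ENNReal.toReal_pos (hN _ ha.1 _ ha.2) (PMF.apply_ne_top _ _)

/-- An irreducible finite chain that stays put with positive probability at every state is
ergodic. -/
theorem isErgodicOn_of_loop (stays : ∀ x ∈ S, (P x).support ⊆ S) (carried : π.support ⊆ S)
    (stationary : π.bind P = π) (loop : ∀ x ∈ S, P x x ≠ 0)
    (irreducible : ∀ x ∈ S, ∀ y ∈ S, ∃ n, nStep P n x y ≠ 0) : IsErgodicOn P S π where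
  stays := stays
  carried := carried
  stationary := stationary
  irreducible := irreducible
  aperiodic x hx d hd := Nat.dvd_one.1 (hd 1 le_rfl (by rw [nStep_one]; exact loop x hx))
  tendsto x hx := by
    have hsup n := support_nStep_subset stays n hx
    have htsum n : ∑' y, |(nStep P n x y).toReal - (π y).toReal| =
        ∑ y ∈ S, |(nStep P n x y).toReal - (π y).toReal| := by
      refine tsum_eq_sum fun y hy => ?_
      have h₁ : nStep P n x y = 0 := by
        by_contra h
        exact hy (hsup n h)
      have h₂ : π y = 0 := by
        by_contra h
        exact hy (carried h)
      simp [h₁, h₂]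
    simp only [htsum]
    set f : ℕ → ℝ := fun n => ∑ y ∈ S, |(nStep P n x y).toReal - (π y).toReal| with hf
    have contract (n N : ℕ) {ε : ℝ} (hε : 0 ≤ ε)
        (h : ∀ x ∈ S, ∀ y ∈ S, ε ≤ (nStep P N x y).toReal) : f (n + N) ≤ (1 - ε) * f n := by
      have := sum_abs_bind_sub_le (fun z hz => support_nStep_subset stays N hz) hε h (hsup n)
        carried
      rwa [bind_nStep stationary, ← nStep_add] at this
    -- The trivial bound `ε = 0` already gives monotonicity; the limit `L` then satisfies `L ≤ (1 -
    -- ε) L` for a positive `ε`, so it vanishes.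
    have hanti : Antitone f := antitone_nat_of_succ_le fun n => by
      simpa using contract n 1 le_rfl fun _ _ _ _ => ENNReal.toReal_nonneg
    have hnonneg n : 0 ≤ f n := Finset.sum_nonneg fun _ _ => abs_nonneg _
    obtain ⟨N, ε, hε, hN⟩ := exists_nStep_pos loop irreducible
    have hlim := tendsto_atTop_ciInf hanti ⟨0, by rintro _ ⟨n, rfl⟩; exact hnonneg n⟩
    have h₁ : ⨅ n, f n ≤ (1 - ε) * ⨅ n, f n :=
      le_of_tendsto_of_tendsto' ((Filter.tendsto_add_atTop_iff_nat N).2 hlim)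
        (hlim.const_mul (1 - ε)) fun n => contract n N hε.le hN
    have h₂ : 0 ≤ ⨅ n, f n := le_ciInf hnonneg
    have : ⨅ n, f n = 0 := by nlinarith
    rwa [this] at hlim

theorem bind_eq_self_of_isReversible (h : IsReversible P π) : π.bind P = π := by
  ext y
  rw [PMF.bind_apply, tsum_congr fun x => h x y, ENNReal.tsum_mul_left, (P y).tsum_coe, mul_one]

theorem isReversible_uniformOfFinset (hS : S.Nonempty) (stays : ∀ x ∈ S, (P x).support ⊆ S)
    (symm : ∀ x y, P x y = P y x) : IsReversible P (PMF.uniformOfFinset S hS) := by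
  have hzero {x y : X} (hx : x ∈ S) (hy : y ∉ S) : P x y = 0 := by
    by_contra h
    exact hy (stays x hx h)
  intro x y
  rw [symm x y, PMF.uniformOfFinset_apply, PMF.uniformOfFinset_apply]
  split_ifs with hx hy hy
  · rfl
  · rw [symm y x, hzero hx hy, mul_zero, mul_zero]
  · rw [hzero hy hx, mul_zero, mul_zero]
  · simp

end Markov

/-! ## The sequences that can be sampled -/

section Walk

variable {V E : Type*} (e : V → V → E) (F : Set E)

/-- `Run e F G Q w₀ prev cur path`: the loop can be running at `G` with first vertex `w₀`, last two
vertices `prev` and `cur` and vertex list `path`, all edges that `path` traverses from an odd to an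
even position being in `Q`. -/
inductive Run (G : E → ℕ) (Q : Set E) (w₀ : V) : Option V → V → List V → Prop
  | start : Run G Q w₀ none w₀ [w₀]
  | step {prev : Option V} {cur : V} {path : List V} {x y : V} : Run G Q w₀ prev cur path →
      0 < G (e x cur) → e x cur ∉ F → prev ≠ some x → (w₀ ≠ cur → e x w₀ ∈ F) →
      y ≠ cur → e x y ∉ F → e x y ∈ Q → Run G Q w₀ (some x) y (path ++ [x, y])

/-- The vertex lists with which the loop can end at `G`. -/
inductive Closed (G : E → ℕ) (Q : Set E) : List V → Prop
  | close {w₀ : V} {prev : Option V} {cur : V} {path : List V} {x : V} :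
      Run e F G Q w₀ prev cur path → 0 < G (e x cur) → e x cur ∉ F → prev ≠ some x →
      w₀ ≠ cur → e x w₀ ∉ F → Closed G Q (path ++ [x, w₀])

/-- `Finish e F G w₀ prev cur l`: the running loop with first vertex `w₀` and last two vertices
`prev` and `cur` can end after passing through the vertices in `l`. -/
inductive Finish (G : E → ℕ) (w₀ : V) : Option V → V → List V → Prop
  | close {prev : Option V} {cur x : V} : 0 < G (e x cur) → e x cur ∉ F → prev ≠ some x →
      w₀ ≠ cur → e x w₀ ∉ F → Finish G w₀ prev cur [x, w₀]
  | step {prev : Option V} {cur x y : V} {l : List V} : 0 < G (e x cur) → e x cur ∉ F →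
      prev ≠ some x → (w₀ ≠ cur → e x w₀ ∈ F) → y ≠ cur → e x y ∉ F →
      Finish G w₀ (some x) y l → Finish G w₀ prev cur (x :: y :: l)

variable {e F} {G : E → ℕ} {Q : Set E} {w₀ : V} {prev : Option V} {cur : V} {path : List V}

theorem Run.mono {Q' : Set E} (hQ : Q ⊆ Q') (h : Run e F G Q w₀ prev cur path) :
    Run e F G Q' w₀ prev cur path := by
  induction h with
  | start => exact .start
  | step _ h₁ h₂ h₃ h₄ h₅ h₆ h₇ ih => exact .step ih h₁ h₂ h₃ h₄ h₅ h₆ (hQ h₇)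

/-- `Run.start` does not record that `W₀` is drawn only if `N_G(W₀)` is nonempty; the first removed
edge gives this back. -/
theorem Run.exists_first (h : Run e F G Q w₀ prev cur path) {x : V} (h₁ : 0 < G (e x cur))
    (h₂ : e x cur ∉ F) : ∃ x, 0 < G (e x w₀) ∧ e x w₀ ∉ F := by
  induction h generalizing x with
  | start => exact ⟨x, h₁, h₂⟩
  | step _ h h' _ _ _ _ _ ih => exact ih h h'

theorem Finish.closed {l : List V} (hl : Finish e F G w₀ prev cur l)
    (h : Run e F G Set.univ w₀ prev cur path) : Closed e F G Set.univ (path ++ l) := by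
  induction hl generalizing path with
  | close h₁ h₂ h₃ h₄ h₅ => exact .close h h₁ h₂ h₃ h₄ h₅
  | @step _ _ x y l h₁ h₂ h₃ h₄ h₅ h₆ _ ih =>
    simpa using ih (.step h h₁ h₂ h₃ h₄ h₅ h₆ trivial)

/-- The running loop returns to its first vertex only by ending. -/
theorem Run.eq_singleton (h : Run e F G Q w₀ prev cur path) (hcur : cur = w₀) : path = [w₀] := by
  cases h with
  | start => rfl
  | step _ _ _ _ h₄ h₅ h₆ _ => exact (h₆ (hcur ▸ h₄ (hcur ▸ h₅))).elim

/-- The reverse of a sequence that the loop can follow at `G` can be followed at any graph `G'` that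
has the edges in `Q`. -/
theorem Run.finish_reverse {G' : E → ℕ} (hG' : ∀ x ∈ Q, 0 < G' x)
    (h : Run e F G Q w₀ prev cur path) (hcur : cur ≠ w₀) {x' : V} (hx' : prev ≠ some x') :
    Finish e F G' w₀ (some x') cur path.reverse.tail := by
  induction h generalizing x' with
  | start => exact (hcur rfl).elim
  | @step prev cur path x y h _ h₂ h₃ h₄ h₅ h₆ h₇ ih =>
    have hx : some x' ≠ some x := fun h => hx' h.symm
    -- If the last pass began at `w₀`, its removed edge `e x w₀` is not fixed and the reversed loop
    -- ends at `x`. Otherwise `h₄` is the very condition that keeps the reversed loop from ending at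
    -- `x`.
    by_cases hc : cur = w₀
    · obtain rfl := h.eq_singleton hc
      subst hc
      exact .close (hG' _ h₇) h₆ hx hcur.symm h₂
    · have : (path ++ [x, y]).reverse.tail = x :: cur :: path.reverse.tail := by
        cases h with
        | start => exact (hc rfl).elim
        | step => simp
      rw [this]
      exact .step (hG' _ h₇) h₆ hx (fun _ => h₄ (Ne.symm hc)) h₅.symm h₂ (ih hc h₃)

theorem Run.exists_append (h : Run e F G Q w₀ prev cur path) :
    ∃ l, path = l ++ [cur] ∧ Even l.length := by
  induction h with
  | start => exact ⟨[], rfl, by simp⟩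
  | @step prev cur path x y _ _ _ _ _ _ _ _ ih =>
    obtain ⟨l, rfl, hl⟩ := ih
    exact ⟨l ++ [cur, x], by simp, by simpa [Nat.even_add] using hl⟩

/-- If the loop can end at `G` with `w`, then it can end with the reverse of `w` at any graph `G'`
that has the edges that `w` traverses from an odd to an even position. -/
theorem Run.closed_reverse {G' : E → ℕ} (hG' : ∀ x ∈ Q, 0 < G' x)
    (h : Run e F G Q w₀ prev cur path) {x : V} (h₂ : e x cur ∉ F) (h₃ : prev ≠ some x)
    (h₄ : w₀ ≠ cur) (h₅ : e x w₀ ∉ F) (h₆ : 0 < G' (e x w₀)) :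
    Closed e F G' Set.univ (path ++ [x, w₀]).reverse := by
  have h₇ := h.finish_reverse hG' h₄.symm h₃
  obtain ⟨l, rfl, -⟩ := h.exists_append
  have := Finish.closed (.step h₆ h₅ (by simp) (fun h => (h rfl).elim) h₄.symm h₂ h₇) .start
  simpa using this

/-! ### Changes of weight along a sequence -/

open Classical in
/-- The indicator function of a possible edge. -/
noncomputable def edgeInd (y : E) : E → ℤ := fun x => if y = x then 1 else 0

theorem edgeInd_self (y : E) : edgeInd y y = 1 := by simp [edgeInd]

theorem edgeInd_of_ne {x y : E} (h : y ≠ x) : edgeInd y x = 0 := by simp [edgeInd, h]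

theorem visits_cons (a b c : V) (l : List V) :
    visits e (a :: b :: c :: l) = edgeInd (e b a) - edgeInd (e b c) + visits e (c :: l) := by
  ext x
  simp [visits, edgeInd]

theorem visits_singleton (a : V) : visits e [a] = 0 := by
  ext x
  simp [visits]

/-- Two vertices are consumed at a time, so a list may be cut only at an even position. -/
theorem visits_append (c : V) (m : List V) : ∀ l : List V, Even l.length →
    visits e (l ++ c :: m) = visits e (l ++ [c]) + visits e (c :: m)
  | [], _ => by simp [visits_singleton]
  | [a], h => by simp at h
  | [a, b], _ => by simp [visits_cons, visits_singleton]
  | a :: b :: d :: l, h => by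
    have := visits_append c m (d :: l) (by simpa [Nat.even_add_one] using h)
    simp only [List.cons_append, visits_cons] at this ⊢
    rw [this, add_assoc]

/-- Odd length preserves the parity of positions under reversal, so removed and added edges are
exchanged. Each edge is written from its odd vertex in both directions, which makes this valid for
directed edges. -/
theorem visits_reverse : ∀ w : List V, Odd w.length → visits e w.reverse = -visits e w
  | [], h => by simp at h
  | [a], _ => by simp [visits_singleton]
  | [a, b], h => by simp [Nat.odd_iff] at h
  | a :: b :: c :: l, h => by
    have hl : Odd (c :: l).length := by
      simp only [List.length_cons, Nat.odd_iff] at h ⊢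
      omega
    have hl' : Even l.reverse.length := by
      simp only [List.length_cons, List.length_reverse, Nat.odd_iff, Nat.even_iff] at h ⊢
      omega
    have ih := visits_reverse (c :: l) hl
    simp only [List.reverse_cons, List.append_assoc, List.cons_append, List.nil_append] at ih ⊢
    rw [visits_append _ _ _ hl', ih, visits_cons, visits_cons, visits_singleton]
    abel

theorem Run.visits_append (h : Run e F G Q w₀ prev cur path) (x y : V) :
    visits e (path ++ [x, y]) = visits e path + edgeInd (e x cur) - edgeInd (e x y) := by
  obtain ⟨l, rfl, hl⟩ := h.exists_append
  rw [List.append_assoc, List.singleton_append, WGS.visits_append _ _ _ hl, visits_cons,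
    visits_singleton]
  abel

theorem Closed.odd_length {w : List V} (h : Closed e F G Q w) : Odd w.length := by
  cases h with
  | close h =>
    obtain ⟨l, rfl, hl⟩ := h.exists_append
    simp only [List.append_assoc, List.length_append, List.length_cons, List.length_nil,
      Nat.odd_iff, Nat.even_iff] at hl ⊢
    omega

theorem Run.visits_eq_zero (h : Run e F G Q w₀ prev cur path) {z : E} (hz : z ∈ F) :
    visits e path z = 0 := by
  induction h with
  | start => simp [visits_singleton]
  | @step _ cur _ x y h _ h₂ _ _ _ h₆ _ ih =>
    have h₇ : e x cur ≠ z := fun h => h₂ (h ▸ hz)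
    have h₈ : e x y ≠ z := fun h => h₆ (h ▸ hz)
    simp [h.visits_append, ih, edgeInd_of_ne h₇, edgeInd_of_ne h₈]

theorem Closed.visits_eq_zero {w : List V} (h : Closed e F G Q w) {z : E} (hz : z ∈ F) :
    visits e w z = 0 := by
  cases h with
  | @close w₀ _ cur _ x h _ h₂ _ _ h₅ =>
    have h₇ : e x cur ≠ z := fun h => h₂ (h ▸ hz)
    have h₈ : e x w₀ ≠ z := fun h => h₅ (h ▸ hz)
    simp [h.visits_append, h.visits_eq_zero hz, edgeInd_of_ne h₇, edgeInd_of_ne h₈]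

/-! ### The support of the law of the sequence -/

variable [Fintype V]

theorem closed_mem_support_walkStep_running {w : List V} :
    .closed w ∈ (walkStep e F G (.running w₀ prev cur path)).support ↔
      ∃ x, 0 < G (e x cur) ∧ e x cur ∉ F ∧ prev ≠ some x ∧ w₀ ≠ cur ∧ e x w₀ ∉ F ∧
        w = path ++ [x, w₀] := by
  classical
  rw [walkStep]
  split_ifs with hA
  · rw [PMF.mem_support_bind_iff]
    refine exists_congr fun x => ?_
    simp only [PMF.support_uniformOfFinset, nbrN, Finset.mem_coe, Finset.mem_filter,
      Finset.mem_univ, true_and, and_assoc]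
    refine and_congr_right fun h₁ => and_congr_right fun h₂ => and_congr_right fun h₃ => ?_
    split_ifs with h hB
    · simp only [nbrM, Finset.mem_erase, Finset.mem_filter, Finset.mem_univ, true_and] at h
      simp [h]
    · simp only [nbrM, Finset.mem_erase, Finset.mem_filter, Finset.mem_univ, true_and] at h
      rw [PMF.support_map]
      simp only [Set.mem_image, reduceCtorEq, and_false, exists_false, false_iff]
      tauto
    · simp only [nbrM, Finset.mem_erase, Finset.mem_filter, Finset.mem_univ, true_and] at h
      simp only [PMF.support_pure, Set.mem_singleton_iff, reduceCtorEq, false_iff]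
      tauto
  · simp only [PMF.support_pure, Set.mem_singleton_iff, reduceCtorEq, false_iff]
    rintro ⟨x, h₁, h₂, h₃, -⟩
    exact hA ⟨x, by simp [nbrN, h₁, h₂, h₃]⟩

theorem running_mem_support_walkStep_running {w₀' : V} {prev' : Option V} {cur' : V}
    {path' : List V} :
    .running w₀' prev' cur' path' ∈ (walkStep e F G (.running w₀ prev cur path)).support ↔
      ∃ x, 0 < G (e x cur) ∧ e x cur ∉ F ∧ prev ≠ some x ∧ (w₀ ≠ cur → e x w₀ ∈ F) ∧
        cur' ≠ cur ∧ e x cur' ∉ F ∧ w₀' = w₀ ∧ prev' = some x ∧ path' = path ++ [x, cur'] := by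
  classical
  rw [walkStep]
  split_ifs with hA
  · rw [PMF.mem_support_bind_iff]
    refine exists_congr fun x => ?_
    simp only [PMF.support_uniformOfFinset, nbrN, Finset.mem_coe, Finset.mem_filter,
      Finset.mem_univ, true_and, and_assoc]
    refine and_congr_right fun h₁ => and_congr_right fun h₂ => and_congr_right fun h₃ => ?_
    split_ifs with h hB
    · simp only [nbrM, Finset.mem_erase, Finset.mem_filter, Finset.mem_univ, true_and] at h
      simp only [PMF.support_pure, Set.mem_singleton_iff, reduceCtorEq, false_iff]
      tauto
    · simp only [nbrM, Finset.mem_erase, Finset.mem_filter, Finset.mem_univ, true_and] at h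
      rw [PMF.support_map]
      simp only [Set.mem_image, PMF.support_uniformOfFinset, nbrM, Finset.mem_coe,
        Finset.mem_erase, Finset.mem_filter, Finset.mem_univ, true_and, WalkState.running.injEq]
      constructor
      · rintro ⟨y, ⟨h₄, h₅⟩, rfl, rfl, rfl, rfl⟩
        exact ⟨by tauto, h₄, h₅, rfl, rfl, rfl⟩
      · rintro ⟨-, h₄, h₅, rfl, rfl, rfl⟩
        exact ⟨_, ⟨h₄, h₅⟩, rfl, rfl, rfl, rfl⟩
    · simp only [PMF.support_pure, Set.mem_singleton_iff, reduceCtorEq, false_iff]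
      rintro ⟨-, h₄, h₅, -⟩
      exact hB ⟨cur', by simp [nbrM, h₄, h₅]⟩
  · simp only [PMF.support_pure, Set.mem_singleton_iff, reduceCtorEq, false_iff]
    rintro ⟨x, h₁, h₂, h₃, -⟩
    exact hA ⟨x, by simp [nbrN, h₁, h₂, h₃]⟩

theorem closed_mem_support_walkStart {w : List V} :
    .closed w ∉ (walkStart e F G).support := by
  classical
  unfold walkStart
  split_ifs
  · rw [PMF.support_map]
    simp
  · simp

theorem running_mem_support_walkStart :
    .running w₀ prev cur path ∈ (walkStart e F G).support ↔
      (∃ x, 0 < G (e x w₀) ∧ e x w₀ ∉ F) ∧ prev = none ∧ cur = w₀ ∧ path = [w₀] := by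
  classical
  have hN (v : V) : (nbrN e F G v).Nonempty ↔ ∃ x, 0 < G (e x v) ∧ e x v ∉ F := by
    simp [Finset.Nonempty, nbrN]
  unfold walkStart
  split_ifs with h
  · rw [PMF.support_map]
    simp only [PMF.support_uniformOfFinset, Set.mem_image, Finset.mem_coe, Finset.mem_filter,
      Finset.mem_univ, true_and, hN, WalkState.running.injEq]
    constructor
    · rintro ⟨v, hv, rfl, rfl, rfl, rfl⟩
      exact ⟨hv, rfl, rfl, rfl⟩
    · rintro ⟨hv, rfl, rfl, rfl⟩
      exact ⟨_, hv, rfl, rfl, rfl, rfl⟩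
  · simp only [PMF.support_pure, Set.mem_singleton_iff, reduceCtorEq, false_iff]
    rintro ⟨hv, -⟩
    exact h ⟨w₀, by simpa [hN] using hv⟩

theorem run_and_closed_of_mem_support_walk (n : ℕ) :
    (∀ w₀ prev cur path, .running w₀ prev cur path ∈ (walk e F G n).support →
      Run e F G Set.univ w₀ prev cur path) ∧
    ∀ w, .closed w ∈ (walk e F G n).support → Closed e F G Set.univ w := by
  induction n with
  | zero =>
    refine ⟨fun w₀ prev cur path h => ?_, fun w h => (closed_mem_support_walkStart h).elim⟩
    obtain ⟨-, rfl, rfl, rfl⟩ := running_mem_support_walkStart.1 h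
    exact .start
  | succ n ih =>
    constructor
    · intro w₀ prev cur path h
      obtain ⟨s, hs, h⟩ := (PMF.mem_support_bind_iff _ _ _).1 h
      cases s with
      | running =>
        obtain ⟨x, h₁, h₂, h₃, h₄, h₅, h₆, rfl, rfl, rfl⟩ :=
          running_mem_support_walkStep_running.1 h
        exact .step (ih.1 _ _ _ _ hs) h₁ h₂ h₃ h₄ h₅ h₆ trivial
      | closed w => simp [walkStep] at h
      | stuck => simp [walkStep] at h
    · intro w h
      obtain ⟨s, hs, h⟩ := (PMF.mem_support_bind_iff _ _ _).1 h
      cases s with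
      | running =>
        obtain ⟨x, h₁, h₂, h₃, h₄, h₅, rfl⟩ := closed_mem_support_walkStep_running.1 h
        exact .close (ih.1 _ _ _ _ hs) h₁ h₂ h₃ h₄ h₅
      | closed w' =>
        obtain rfl : w = w' := by simpa [walkStep] using h
        exact ih.2 w hs
      | stuck => simp [walkStep] at h

theorem seqProb_ne_zero_iff {w : List V} :
    seqProb e F G w ≠ 0 ↔ ∃ n, .closed w ∈ (walk e F G n).support := by
  simp [seqProb, PMF.mem_support_iff]

theorem Closed.of_seqProb_ne_zero {w : List V} (h : seqProb e F G w ≠ 0) :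
    Closed e F G Set.univ w := by
  obtain ⟨n, hn⟩ := seqProb_ne_zero_iff.1 h
  exact (run_and_closed_of_mem_support_walk n).2 w hn

theorem Run.exists_mem_support_walk (h : Run e F G Q w₀ prev cur path)
    (h₀ : ∃ x, 0 < G (e x w₀) ∧ e x w₀ ∉ F) :
    ∃ n, .running w₀ prev cur path ∈ (walk e F G n).support := by
  induction h with
  | start => exact ⟨0, running_mem_support_walkStart.2 ⟨h₀, rfl, rfl, rfl⟩⟩
  | step _ h₁ h₂ h₃ h₄ h₅ h₆ _ ih =>
    obtain ⟨n, hn⟩ := ih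
    exact ⟨n + 1, (PMF.mem_support_bind_iff _ _ _).2 ⟨_, hn,
      running_mem_support_walkStep_running.2 ⟨_, h₁, h₂, h₃, h₄, h₅, h₆, rfl, rfl, rfl⟩⟩⟩

theorem Closed.seqProb_ne_zero {w : List V} (h : Closed e F G Q w) : seqProb e F G w ≠ 0 := by
  cases h with
  | close h h₁ h₂ h₃ h₄ h₅ =>
    obtain ⟨n, hn⟩ := h.exists_mem_support_walk (h.exists_first h₁ h₂)
    exact seqProb_ne_zero_iff.2 ⟨n + 1, (PMF.mem_support_bind_iff _ _ _).2 ⟨_, hn,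
      closed_mem_support_walkStep_running.2 ⟨_, h₁, h₂, h₃, h₄, h₅, rfl⟩⟩⟩

end Walk

/-! ## Symmetry of the sampler -/

section Symmetry

variable {V E : Type*} {e : V → V → E} {F : Set E} {G G' : E → ℕ} {w : List V} {Δ : ℤ}

theorem shift_zero (G : E → ℕ) (w : List V) : shift e G w 0 = G := by
  ext x
  simp [shift]

theorem admissible_zero (G : E → ℕ) (w : List V) : Admissible e G w 0 := fun x => by simp

theorem Admissible.shift_apply (h : Admissible e G w Δ) (x : E) :
    (shift e G w Δ x : ℤ) = G x + visits e w x * Δ :=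
  Int.toNat_of_nonneg (h x)

theorem admissible_and_shift_eq_iff :
    Admissible e G w Δ ∧ shift e G w Δ = G' ↔ ∀ x, (G' x : ℤ) = G x + visits e w x * Δ := by
  constructor
  · rintro ⟨h, rfl⟩ x
    exact h.shift_apply x
  · intro h
    refine ⟨fun x => by rw [← h]; positivity, funext fun x => ?_⟩
    rw [shift, ← h, Int.toNat_natCast]

theorem delta_unique (hne : G ≠ G') (h : ∀ x, (G' x : ℤ) = G x + visits e w x * Δ) {Δ' : ℤ}
    (h' : ∀ x, (G' x : ℤ) = G x + visits e w x * Δ') : Δ' = Δ := by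
  obtain ⟨x, hx⟩ := Function.ne_iff.1 hne
  have hv : visits e w x ≠ 0 := fun hv => hx (by simpa [hv, eq_comm] using h x)
  exact mul_left_cancel₀ hv (add_left_cancel ((h' x).symm.trans (h x)))

theorem exists_delta_symm (h : ∃ Δ : ℤ, ∀ x, (G' x : ℤ) = G x + visits e w x * Δ) :
    ∃ Δ : ℤ, ∀ x, (G x : ℤ) = G' x + visits e w x * Δ := by
  obtain ⟨Δ, h⟩ := h
  exact ⟨-Δ, fun x => by rw [h]; ring⟩

variable [Fintype V]

theorem classProb_reverse (G : E → ℕ) (w : List V) :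
    classProb e F G w.reverse = classProb e F G w := by
  classical
  rw [classProb, classProb, List.reverse_reverse, Finset.pair_comm]

theorem classProb_ne_top (G : E → ℕ) (w : List V) : classProb e F G w ≠ ∞ :=
  ENNReal.sum_ne_top.2 fun w' _ =>
    ((ENNReal.le_tsum w').trans (tsum_seqProb_le_one e F G)).trans_lt ENNReal.one_lt_top |>.ne

theorem seqProb_le_classProb (G : E → ℕ) (w : List V) :
    seqProb e F G w ≤ classProb e F G w :=
  Finset.single_le_sum (f := seqProb e F G) (fun _ _ => zero_le) (by simp)

open Classical in
-- The class of a palindrome has one element, which the left side counts twice.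
theorem seqProb_add_seqProb_reverse (G : E → ℕ) (w : List V) :
    seqProb e F G w + seqProb e F G w.reverse =
      (if w = w.reverse then 2 else 1) * classProb e F G w := by
  split_ifs with h
  · rw [classProb, ← h]
    simp [two_mul]
  · rw [classProb, Finset.sum_pair h, one_mul]

theorem deltaWeight_eq (h : ∀ x, (G' x : ℤ) = G x + visits e w x * Δ) :
    deltaWeight e F G w Δ = classProb e F G' w := by
  obtain ⟨h', rfl⟩ := admissible_and_shift_eq_iff.2 h
  rw [deltaWeight, if_pos h']

theorem deltaWeight_zero (G : E → ℕ) (w : List V) :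
    deltaWeight e F G w 0 = classProb e F G w :=
  deltaWeight_eq fun x => by simp

theorem deltaWeight_congr {w' : List V} {Δ' : ℤ}
    (h : ∀ x, (G x : ℤ) + visits e w x * Δ = G' x + visits e w' x * Δ')
    (hw : ∀ G, classProb e F G w = classProb e F G w') :
    deltaWeight e F G w Δ = deltaWeight e F G' w' Δ' := by
  have hadm : Admissible e G w Δ ↔ Admissible e G' w' Δ' := by simp only [Admissible, h]
  have hshift : shift e G w Δ = shift e G' w' Δ' := funext fun x => by simp only [shift, h]
  by_cases hΔ : Admissible e G w Δ
  · rw [deltaWeight, deltaWeight, if_pos hΔ, if_pos (hadm.1 hΔ), hshift, hw]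
  · rw [deltaWeight, deltaWeight, if_neg hΔ, if_neg (mt hadm.2 hΔ)]

theorem deltaWeight_add (h : ∀ x, (G' x : ℤ) = G x + visits e w x * Δ) (Δ' : ℤ) :
    deltaWeight e F G w (Δ + Δ') = deltaWeight e F G' w Δ' :=
  deltaWeight_congr (fun x => by rw [h]; ring) fun _ => rfl

/-- Both graphs lie on the same line, and a change of base point only translates the parameter. -/
theorem tsum_deltaWeight_eq (h : ∀ x, (G' x : ℤ) = G x + visits e w x * Δ) :
    ∑' Δ, deltaWeight e F G' w Δ = ∑' Δ, deltaWeight e F G w Δ := by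
  rw [← (Equiv.addLeft Δ).tsum_eq (deltaWeight e F G w)]
  exact tsum_congr fun Δ' => (deltaWeight_add h Δ').symm

theorem deltaWeight_reverse (hw : Odd w.length) (Δ : ℤ) :
    deltaWeight e F G w.reverse Δ = deltaWeight e F G w (-Δ) :=
  deltaWeight_congr (fun x => by simp [visits_reverse w hw]) fun G => classProb_reverse G w

theorem tsum_deltaWeight_reverse (hw : Odd w.length) :
    ∑' Δ, deltaWeight e F G w.reverse Δ = ∑' Δ, deltaWeight e F G w Δ := by
  rw [← (Equiv.neg ℤ).tsum_eq (deltaWeight e F G w)]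
  exact tsum_congr fun Δ => deltaWeight_reverse hw Δ

theorem deltaLaw_ne_zero (h : deltaLaw e F G w Δ ≠ 0) : Admissible e G w Δ := by
  rw [deltaLaw] at h
  split_ifs at h with h'
  · rw [PMF.normalize_apply, deltaWeight] at h
    by_contra hΔ
    simp [hΔ] at h
  · obtain rfl : Δ = 0 := by
      by_contra hΔ
      simp [PMF.pure_apply, hΔ] at h
    exact admissible_zero G w

theorem deltaLaw_zero_ne_zero (hw : seqProb e F G w ≠ 0) : deltaLaw e F G w 0 ≠ 0 := by
  rw [deltaLaw]
  split_ifs with h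
  · rw [PMF.normalize_apply, deltaWeight_zero]
    refine mul_ne_zero (fun h => hw ?_) (ENNReal.inv_ne_zero.2 h.2)
    exact le_antisymm (h ▸ seqProb_le_classProb G w) zero_le
  · simp

/-- The probability of moving from `G` to a different graph on the line through `G` given by `w`. -/
theorem map_shift_apply_of_exists (hne : G ≠ G')
    (h : ∃ Δ : ℤ, ∀ x, (G' x : ℤ) = G x + visits e w x * Δ) :
    (deltaLaw e F G w).map (shift e G w) G' =
      classProb e F G' w * (∑' Δ, deltaWeight e F G w Δ)⁻¹ := by
  classical
  obtain ⟨Δ, hΔ⟩ := h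
  have hΔ' := admissible_and_shift_eq_iff.2 hΔ
  have hΔ₀ : Δ ≠ 0 := by
    rintro rfl
    exact hne (by rw [← hΔ'.2, shift_zero])
  rw [PMF.map_apply, tsum_eq_single Δ fun Δ' hΔ' => ?_, if_pos hΔ'.2.symm, deltaLaw]
  · split_ifs with hT
    · rw [PMF.normalize_apply, deltaWeight_eq hΔ]
    -- In the default case `Δ = 0` both sides vanish: a zero sum kills the weight, an infinite one
    -- its inverse.
    · rw [not_and_or, not_not, not_not] at hT
      rw [PMF.pure_apply, if_neg hΔ₀]
      rcases hT with hT | hT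
      · rw [← deltaWeight_eq hΔ, ENNReal.tsum_eq_zero.1 hT, zero_mul]
      · rw [hT, ENNReal.inv_top, mul_zero]
  · rw [ite_eq_right_iff]
    intro h
    by_contra hne0
    exact hΔ' (delta_unique hne hΔ
      (admissible_and_shift_eq_iff.1 ⟨deltaLaw_ne_zero hne0, h.symm⟩))

theorem map_shift_apply_of_not_exists
    (h : ¬∃ Δ : ℤ, ∀ x, (G' x : ℤ) = G x + visits e w x * Δ) :
    (deltaLaw e F G w).map (shift e G w) G' = 0 := by
  by_contra hne
  rw [← Ne, ← PMF.mem_support_iff, PMF.support_map] at hne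
  obtain ⟨Δ, hΔ, h'⟩ := hne
  exact h ⟨Δ, admissible_and_shift_eq_iff.1 ⟨deltaLaw_ne_zero hΔ, h'⟩⟩

/-- Both sides are the product of the two class probabilities divided by the common sum along the
line. -/
theorem classProb_mul_map_shift_comm (hne : G ≠ G') (w : List V) :
    classProb e F G w * (deltaLaw e F G w).map (shift e G w) G' =
      classProb e F G' w * (deltaLaw e F G' w).map (shift e G' w) G := by
  by_cases h : ∃ Δ : ℤ, ∀ x, (G' x : ℤ) = G x + visits e w x * Δ
  · rw [map_shift_apply_of_exists hne h,
      map_shift_apply_of_exists hne.symm (exists_delta_symm h),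
      tsum_deltaWeight_eq h.choose_spec, mul_left_comm]
  · rw [map_shift_apply_of_not_exists h,
      map_shift_apply_of_not_exists fun h' => h (exists_delta_symm h'), mul_zero, mul_zero]

theorem map_shift_reverse (hne : G ≠ G') (hw : Odd w.length) :
    (deltaLaw e F G w.reverse).map (shift e G w.reverse) G' =
      (deltaLaw e F G w).map (shift e G w) G' := by
  have hrev : (∃ Δ : ℤ, ∀ x, (G' x : ℤ) = G x + visits e w.reverse x * Δ) ↔
      ∃ Δ : ℤ, ∀ x, (G' x : ℤ) = G x + visits e w x * Δ := by
    rw [(Equiv.neg ℤ).exists_congr_left]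
    simp [visits_reverse w hw]
  by_cases h : ∃ Δ : ℤ, ∀ x, (G' x : ℤ) = G x + visits e w x * Δ
  · rw [map_shift_apply_of_exists hne h, map_shift_apply_of_exists hne (hrev.2 h),
      classProb_reverse, tsum_deltaWeight_reverse hw]
  · rw [map_shift_apply_of_not_exists h, map_shift_apply_of_not_exists (mt hrev.1 h)]

theorem sampler_apply_of_ne (hne : G ≠ G') :
    sampler e F G G' =
      ∑' w, seqProb e F G w * (deltaLaw e F G w).map (shift e G w) G' := by
  classical
  rw [sampler, PMF.bind_apply, ← Function.Injective.tsum_eq (Option.some_injective _)]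
  · rfl
  · rintro (_ | w) h
    · simp [PMF.pure_apply, hne.symm] at h
    · exact ⟨w, rfl⟩

open Classical in
-- Averaging over `w` and its reverse replaces `seqProb` by `classProb`; the palindrome factor does
-- not involve the graphs, so symmetry is not affected.
theorem two_mul_sampler_apply (hne : G ≠ G') :
    2 * sampler e F G G' = ∑' w : List V, (if w = w.reverse then 2 else 1) *
      (classProb e F G w * (deltaLaw e F G w).map (shift e G w) G') := by
  have hrev : sampler e F G G' =
      ∑' w, seqProb e F G w.reverse * (deltaLaw e F G w).map (shift e G w) G' := by
    rw [sampler_apply_of_ne hne,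
      ← (List.reverse_involutive.toPerm : Equiv.Perm (List V)).tsum_eq]
    refine tsum_congr fun w => ?_
    change seqProb e F G w.reverse * (deltaLaw e F G w.reverse).map (shift e G w.reverse) G' = _
    -- The reversal identity needs odd length, which holds for sequences that can be sampled; the
    -- other terms vanish.
    by_cases hw : seqProb e F G w.reverse = 0
    · rw [hw, zero_mul, zero_mul]
    · rw [map_shift_reverse hne]
      simpa using (Closed.of_seqProb_ne_zero hw).odd_length
  rw [two_mul]
  nth_rewrite 1 [sampler_apply_of_ne hne]
  rw [hrev, ← ENNReal.tsum_add]
  refine tsum_congr fun w => ?_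
  rw [← add_mul, seqProb_add_seqProb_reverse, mul_assoc]

/-- The transition probabilities of the sampler are symmetric. -/
theorem sampler_comm (e : V → V → E) (F : Set E) (G G' : E → ℕ) :
    sampler e F G G' = sampler e F G' G := by
  classical
  by_cases hne : G = G'
  · rw [hne]
  · refine (ENNReal.mul_right_inj two_ne_zero ENNReal.ofNat_ne_top).1 ?_
    rw [two_mul_sampler_apply hne, two_mul_sampler_apply (Ne.symm hne)]
    exact tsum_congr fun w => by rw [classProb_mul_map_shift_comm hne]

theorem sampler_self_ne_zero (e : V → V → E) (F : Set E) (G : E → ℕ) :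
    sampler e F G G ≠ 0 := by
  rw [← PMF.mem_support_iff, sampler, PMF.mem_support_bind_iff]
  obtain ⟨o, ho⟩ := (seqLaw e F G).support_nonempty
  refine ⟨o, ho, ?_⟩
  cases o with
  | none => simp
  | some w =>
    rw [PMF.support_map]
    exact ⟨0, deltaLaw_zero_ne_zero ho, shift_zero G w⟩

theorem exists_closed_of_mem_support_sampler (h : G' ∈ (sampler e F G).support) :
    G' = G ∨ ∃ w, Closed e F G Set.univ w ∧
      ∃ Δ : ℤ, ∀ x, (G' x : ℤ) = G x + visits e w x * Δ := by
  rw [sampler, PMF.mem_support_bind_iff] at h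
  obtain ⟨o, ho, h⟩ := h
  cases o with
  | none => exact .inl (by simpa using h)
  | some w =>
    rw [PMF.support_map] at h
    obtain ⟨Δ, hΔ, h⟩ := h
    exact .inr ⟨w, Closed.of_seqProb_ne_zero ho, Δ,
      admissible_and_shift_eq_iff.1 ⟨deltaLaw_ne_zero hΔ, h⟩⟩

theorem sampler_ne_zero (hne : G ≠ G') (hw : seqProb e F G w ≠ 0)
    (h : ∀ x, (G' x : ℤ) = G x + visits e w x * Δ) (hG' : classProb e F G' w ≠ 0)
    (hfin : {Δ | Admissible e G w Δ}.Finite) : sampler e F G G' ≠ 0 := by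
  have hT : ∑' Δ, deltaWeight e F G w Δ ≠ ∞ := by
    rw [tsum_eq_sum (s := hfin.toFinset) fun Δ hΔ => ?_]
    · refine ENNReal.sum_ne_top.2 fun Δ hΔ => ?_
      rw [deltaWeight]
      split_ifs
      · exact classProb_ne_top _ _
      · simp
    · exact if_neg (by simpa using hΔ)
  rw [sampler_apply_of_ne hne, Ne, ENNReal.tsum_eq_zero]
  intro h0
  refine mul_ne_zero hw ?_ (h0 w)
  rw [map_shift_apply_of_exists hne ⟨Δ, h⟩]
  exact mul_ne_zero hG' (ENNReal.inv_ne_zero.2 hT)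

end Symmetry

/-! ## Irreducibility of the sampler

Directed and undirected graphs are treated together: the strengths are the values of a homomorphism
`bd`, and a sequence of edges that leads from `a` to `c` through alternately removed and added edges
changes the strengths by a coboundary. -/

section Irreducibility

variable {V E M : Type*} [AddCommGroup M]

/-- The properties of the strengths that the sampler depends on. -/
structure Incidence (e : V → V → E) (M : Type*) [AddCommGroup M] where
  /-- The strengths of a signed weight function. -/
  bd : (E → ℤ) →+ M
  /-- The contribution of a vertex to the strengths. -/
  vert : V → M
  surj : ∀ x, ∃ b a, e b a = x
  bd_sub : ∀ a b c, bd (edgeInd (e b a) - edgeInd (e b c)) = vert a - vert c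
  exists_pos : ∀ {D : E → ℤ} {a c : V}, c ≠ a → bd D = vert c - vert a → ∃ b, 0 < D (e b c)
  exists_neg : ∀ {D : E → ℤ} {a c : V}, bd D = vert c - vert a →
    ∀ b, ∃ v, (D - edgeInd (e b c)) (e b v) < 0
  exists_pos_of_neg : ∀ {D : E → ℤ} {a b : V}, bd D = 0 → D (e b a) < 0 → ∃ b', 0 < D (e b' a)

variable {e : V → V → E} {F : Set E} {G G' G₀ H : E → ℕ} {Q : Set E} {w₀ : V} {prev : Option V}
  {cur : V} {path w : List V} {D D₀ : E → ℤ}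

namespace Incidence

variable (I : Incidence e M)

theorem bd_visits_run (h : Run e F G Q w₀ prev cur path) :
    I.bd (visits e path) = I.vert w₀ - I.vert cur := by
  induction h with
  | start => simp [visits_singleton]
  | step h _ _ _ _ _ _ _ ih => rw [h.visits_append, add_sub_assoc, map_add, ih, I.bd_sub]; abel

theorem bd_visits_closed (h : Closed e F G Q w) : I.bd (visits e w) = 0 := by
  cases h with
  | close h => rw [h.visits_append, add_sub_assoc, map_add, I.bd_visits_run h, I.bd_sub]; abel

/-- The graphs with the strengths of `G₀` and the weights of `G₀` on `F`. -/
def graphs (G₀ : E → ℕ) (F : Set E) : Set (E → ℕ) :=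
  {G | I.bd (fun x => (G x : ℤ) - G₀ x) = 0 ∧ ∀ x ∈ F, G x = G₀ x}

variable {I}

theorem mem_graphs_of_closed (hG : G ∈ I.graphs G₀ F) (hw : Closed e F H Q w) {Δ : ℤ}
    (h : ∀ x, (G' x : ℤ) = G x + visits e w x * Δ) : G' ∈ I.graphs G₀ F := by
  constructor
  · have : (fun x => (G' x : ℤ) - G₀ x) = (fun x => (G x : ℤ) - G₀ x) + Δ • visits e w := by
      ext x
      simp only [h, Pi.add_apply, Pi.smul_apply, smul_eq_mul]
      ring
    rw [this, map_add, map_zsmul, hG.1, I.bd_visits_closed hw, smul_zero, add_zero]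
  · intro x hx
    have := h x
    rw [hw.visits_eq_zero hx, zero_mul, add_zero, hG.2 x hx] at this
    exact_mod_cast this

/-- If `n_w ≠ 0`, distinct `Δ` give distinct graphs of a finite set. This makes the normalizing sum
finite. -/
theorem finite_admissible (hfin : (I.graphs G₀ F).Finite) (hG : G ∈ I.graphs G₀ F)
    (hw : Closed e F H Q w) (hne : visits e w ≠ 0) : {Δ | Admissible e G w Δ}.Finite := by
  refine Set.Finite.of_injOn (f := shift e G w)
    (fun Δ hΔ => mem_graphs_of_closed hG hw hΔ.shift_apply) ?_ hfin
  intro Δ hΔ Δ' hΔ' h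
  obtain ⟨x, hx⟩ := Function.ne_iff.1 hne
  refine mul_left_cancel₀ hx (add_left_cancel (a := (G x : ℤ)) ?_)
  rw [← hΔ.shift_apply, ← hΔ'.shift_apply, h]

theorem support_sampler_subset [Fintype V] (hG : G ∈ I.graphs G₀ F) :
    (sampler e F G).support ⊆ I.graphs G₀ F := by
  intro G' hG'
  rcases exists_closed_of_mem_support_sampler hG' with rfl | ⟨w, hw, Δ, h⟩
  · exact hG
  · exact mem_graphs_of_closed hG hw h

end Incidence

/-! ### The `ℓ¹` norm under a change of one edge -/

section Sums

variable [Fintype E]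

theorem sum_edgeInd (y : E) : ∑ x, edgeInd y x = 1 := by
  classical
  simp [edgeInd]

theorem sum_abs_sub_edgeInd {y : E} (h : 0 < D y) :
    ∑ x, |(D - edgeInd y) x| = ∑ x, |D x| - 1 := by
  rw [← sum_edgeInd y, ← Finset.sum_sub_distrib]
  refine Finset.sum_congr rfl fun x _ => ?_
  by_cases hx : y = x
  · subst hx
    rw [Pi.sub_apply, edgeInd_self, abs_of_pos h, abs_of_nonneg (by omega)]
  · simp [edgeInd_of_ne hx]

theorem sum_abs_add_edgeInd {y : E} (h : D y < 0) :
    ∑ x, |(D + edgeInd y) x| = ∑ x, |D x| - 1 := by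
  rw [← sum_edgeInd y, ← Finset.sum_sub_distrib]
  refine Finset.sum_congr rfl fun x _ => ?_
  by_cases hx : y = x
  · subst hx
    rw [Pi.add_apply, edgeInd_self, abs_of_neg h, abs_of_nonpos (by omega)]
    ring
  · simp [edgeInd_of_ne hx]

theorem sum_abs_add_edgeInd_le (D : E → ℤ) (y : E) :
    ∑ x, |(D + edgeInd y) x| ≤ ∑ x, |D x| + 1 := by
  rw [← sum_edgeInd y, ← Finset.sum_add_distrib]
  refine Finset.sum_le_sum fun x _ => (abs_add_le _ _).trans_eq ?_
  by_cases hx : y = x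
  · subst hx
    simp [edgeInd_self]
  · simp [edgeInd_of_ne hx]

end Sums

/-! ### Trails inside the difference of two graphs -/

variable [Fintype E]

/-- A path along which the loop can run at `G` and which removes edges where `D₀` is positive and
adds edges where `D₀` is negative, `D` being the part of `D₀` that is left. -/
structure Trail (e : V → V → E) (F : Set E) (G : E → ℕ) (D₀ : E → ℤ) (w₀ : V) (prev : Option V)
    (cur : V) (path : List V) (D : E → ℤ) : Prop where
  -- Edges of this set have gained weight on the way and are never removed, so they are present
  -- after the move, as the reversed run requires.
  run : Run e F G {x | D₀ x < 0 ∧ D₀ x < D x} w₀ prev cur path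
  eq : D = D₀ - visits e path
  nonneg : ∀ x, 0 ≤ D₀ x → 0 ≤ D x ∧ D x ≤ D₀ x
  nonpos : ∀ x, D₀ x < 0 → D₀ x ≤ D x ∧ D x ≤ 0
  -- The edge just added lies where `D₀` is negative, so it is never the next one to be removed:
  -- backtracking is excluded.
  prev_neg : ∀ x, prev = some x → D₀ (e x cur) < 0
  -- This strict gain survives the closing edge.
  lt : cur ≠ w₀ → ∑ x, |D x| < ∑ x, |D₀ x|

theorem Trail.pos (h : Trail e F G D₀ w₀ prev cur path D) {x : E} (hx : 0 < D x) :
    D x ≤ D₀ x := by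
  rcases lt_or_ge (D₀ x) 0 with h₀ | h₀
  · exact absurd (h.nonpos x h₀).2 hx.not_ge
  · exact (h.nonneg x h₀).2

theorem Trail.neg (h : Trail e F G D₀ w₀ prev cur path D) {x : E} (hx : D x < 0) : D₀ x < 0 := by
  by_contra h₀
  exact absurd (h.nonneg x (not_lt.1 h₀)).1 hx.not_ge

theorem Trail.prev_ne (h : Trail e F G D₀ w₀ prev cur path D) {x : V} (hx : 0 < D (e x cur)) :
    prev ≠ some x := fun hp => by
  have := h.pos hx
  have := h.prev_neg x hp
  omega

variable (I : Incidence e M)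

theorem Trail.exists_step (h : Trail e F G D₀ w₀ prev cur path D) (hbd : I.bd D₀ = 0)
    (hG : ∀ x, D₀ x ≤ G x) (hF : ∀ x ∈ F, D₀ x = 0) {x : V} (hx : 0 < D (e x cur))
    (hc : w₀ ≠ cur → e x w₀ ∈ F) :
    ∃ y D', Trail e F G D₀ w₀ (some x) y (path ++ [x, y]) D' ∧ y ≠ w₀ ∧
      ∑ z, |D' z| < ∑ z, |D z| := by
  have hbdD : I.bd D = I.vert cur - I.vert w₀ := by
    rw [h.eq, map_sub, hbd, I.bd_visits_run h.run]
    abel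
  -- Removing `e x cur` leaves a deficit at `x`, so some edge at `x` is to be added.
  obtain ⟨y, hy⟩ := I.exists_neg hbdD x
  have hne : e x cur ≠ e x y := fun hne => by
    rw [← hne, Pi.sub_apply, edgeInd_self] at hy
    omega
  have hDy : D (e x y) < 0 := by simpa [edgeInd_of_ne hne] using hy
  have hycur : y ≠ cur := fun h => hne (by rw [h])
  have hxF : e x cur ∉ F := fun hF' => by
    have := h.pos hx
    have := hF _ hF'
    omega
  have hyF : e x y ∉ F := fun hF' => by
    have := h.neg hDy
    have := hF _ hF'
    omega
  -- The loop has not closed, so for `cur ≠ w₀` the edge `e x w₀` is fixed, whereas `e x y` is not.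
  have hyw : y ≠ w₀ := by
    rintro rfl
    exact hyF (hc hycur)
  have hGx : 0 < G (e x cur) := by
    have := h.pos hx
    have := hG (e x cur)
    omega
  set D' := D - edgeInd (e x cur) + edgeInd (e x y) with hD'
  have hsum : ∑ z, |D' z| = ∑ z, |D z| - 1 - 1 := by
    rw [hD', sum_abs_add_edgeInd hy, sum_abs_sub_edgeInd hx]
  have hx₀ := h.pos hx
  have hy₀ := h.neg hDy
  have hcases (z : E) : (z = e x cur ∧ D' z = D z - 1) ∨ (z = e x y ∧ D' z = D z + 1) ∨
      D' z = D z := by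
    by_cases h₁ : e x cur = z
    · subst h₁
      left
      simp [hD', edgeInd_self, edgeInd_of_ne hne.symm]
    · by_cases h₂ : e x y = z
      · subst h₂
        right; left
        simp [hD', edgeInd_self, edgeInd_of_ne hne]
      · right; right
        simp [hD', edgeInd_of_ne h₁, edgeInd_of_ne h₂]
  refine ⟨y, D', ⟨.step (h.run.mono ?_) hGx hxF (h.prev_ne hx) hc hycur hyF ⟨hy₀, ?_⟩, ?_, ?_, ?_,
    ?_, ?_⟩, hyw, by omega⟩
  · rintro z ⟨hz, hz'⟩
    refine ⟨hz, ?_⟩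
    rcases hcases z with ⟨rfl, _⟩ | ⟨rfl, _⟩ | _ <;> omega
  · have := (h.nonpos _ hy₀).1
    rcases hcases (e x y) with ⟨h', _⟩ | ⟨-, _⟩ | h'
    · exact absurd h'.symm hne
    · omega
    · simp [hD', edgeInd_self, edgeInd_of_ne hne] at h'
  · rw [hD', h.run.visits_append, h.eq]
    abel
  · intro z hz
    have := h.nonneg z hz
    rcases hcases z with ⟨rfl, _⟩ | ⟨rfl, _⟩ | _ <;> omega
  · intro z hz
    have := h.nonpos z hz
    rcases hcases z with ⟨rfl, _⟩ | ⟨rfl, _⟩ | _ <;> omega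
  · rintro _ ⟨⟩
    exact hy₀
  · intro _
    by_cases hcur : cur = w₀
    · obtain rfl := h.run.eq_singleton hcur
      have : D = D₀ := by simp [h.eq, visits_singleton]
      subst this
      omega
    · have := h.lt hcur
      omega

/-- Each step lowers the norm of `D` and arrives at a vertex other than `w₀`, where the boundary of
`D` forces another positive edge; the process must therefore close. -/
theorem Trail.exists_close (hbd : I.bd D₀ = 0) (hG : ∀ x, D₀ x ≤ G x)
    (hF : ∀ x ∈ F, D₀ x = 0) (h : Trail e F G D₀ w₀ prev cur path D)
    (hcur : ∃ x, 0 < D (e x cur)) :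
    ∃ prev cur path D x, Trail e F G D₀ w₀ prev cur path D ∧ 0 < D (e x cur) ∧ w₀ ≠ cur ∧
      e x w₀ ∉ F := by
  induction hn : (∑ z, |D z|).toNat using Nat.strong_induction_on generalizing prev cur path D with
  | _ n ih =>
    obtain ⟨x, hx⟩ := hcur
    by_cases hc : w₀ ≠ cur → e x w₀ ∈ F
    · obtain ⟨y, D', hD', hy, hlt⟩ := h.exists_step I hbd hG hF hx hc
      have hnn : 0 ≤ ∑ z, |D' z| := Finset.sum_nonneg fun _ _ => abs_nonneg _
      refine ih _ (by omega) hD' (I.exists_pos hy ?_) rfl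
      rw [hD'.eq, map_sub, hbd, I.bd_visits_run hD'.run]
      abel
    · rw [Classical.not_imp] at hc
      exact ⟨_, _, _, _, x, h, hx, hc⟩

theorem exists_trail_close (hbd : I.bd D₀ = 0) (hG : ∀ x, D₀ x ≤ G x)
    (hF : ∀ x ∈ F, D₀ x = 0) (hne : D₀ ≠ 0) :
    ∃ w₀ prev cur path D x, Trail e F G D₀ w₀ prev cur path D ∧ 0 < D (e x cur) ∧ w₀ ≠ cur ∧
      e x w₀ ∉ F := by
  obtain ⟨w₀, hw₀⟩ : ∃ w₀ x, 0 < D₀ (e x w₀) := by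
    obtain ⟨z, hz⟩ := Function.ne_iff.1 hne
    obtain ⟨b, a, rfl⟩ := I.surj z
    rcases lt_or_gt_of_ne hz with hz | hz
    · exact ⟨a, I.exists_pos_of_neg hbd hz⟩
    · exact ⟨a, b, hz⟩
  refine ⟨w₀, Trail.exists_close I hbd hG hF (prev := none) (path := [w₀]) (D := D₀) ?_ hw₀⟩
  exact ⟨.start, by simp [visits_singleton], fun _ h => ⟨h, le_rfl⟩, fun _ h => ⟨le_rfl, h.le⟩,
    fun _ h => by simp at h, fun h => (h rfl).elim⟩

variable {I} [Fintype V]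

/-- The sampler can move from `G` towards any other graph `H`. -/
theorem Incidence.exists_closer (hfin : (I.graphs G₀ F).Finite) (hG : G ∈ I.graphs G₀ F)
    (hH : H ∈ I.graphs G₀ F) (hne : G ≠ H) :
    ∃ G' ∈ I.graphs G₀ F, sampler e F G G' ≠ 0 ∧
      ∑ x, |(G' x : ℤ) - H x| < ∑ x, |(G x : ℤ) - H x| := by
  set D₀ : E → ℤ := fun x => (G x : ℤ) - H x with hD₀
  have hbd : I.bd D₀ = 0 := by
    have : D₀ = (fun x => (G x : ℤ) - G₀ x) - fun x => (H x : ℤ) - G₀ x := by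
      ext x
      simp [hD₀]
    rw [this, map_sub, hG.1, hH.1, sub_zero]
  have hne₀ : D₀ ≠ 0 := fun h => hne <| funext fun x => by
    have := congrFun h x
    simp only [hD₀, Pi.zero_apply] at this
    omega
  obtain ⟨w₀, prev, cur, path, D, x, h, hx, hcur, hc⟩ :=
    exists_trail_close I (F := F) (G := G) hbd (fun x => by simp [hD₀])
      (fun x hx => by simp [hD₀, hG.2 x hx, hH.2 x hx]) hne₀
  have hx₀ := h.pos hx
  have hxF : e x cur ∉ F := fun hF => by
    simp only [hD₀, hG.2 _ hF, hH.2 _ hF] at hx₀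
    omega
  have hGx : 0 < G (e x cur) := by
    simp only [hD₀] at hx₀
    omega
  -- Where `D₀` is negative, `H + D ≥ H + D₀ = G ≥ 0`, strictly if the edge was added; elsewhere `D
  -- ≥ 0`. The removed edge has `D ≥ 1`.
  have hlow (z : E) : 0 ≤ H z + (D - edgeInd (e x cur)) z ∧
      (D₀ z < 0 → D₀ z < D z → 0 < H z + (D - edgeInd (e x cur)) z) := by
    rw [Pi.sub_apply]
    by_cases hz : e x cur = z
    · subst hz
      rw [edgeInd_self]
      exact ⟨by omega, fun _ _ => by omega⟩
    · rw [edgeInd_of_ne hz]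
      have h₁ := h.nonneg z
      have h₂ := h.nonpos z
      simp only [hD₀] at h₁ h₂ ⊢
      exact ⟨by omega, fun _ _ => by omega⟩
  have hind (z : E) : 0 ≤ edgeInd (e x w₀) z := by
    unfold edgeInd
    split_ifs <;> simp
  let G' : E → ℕ := fun z => (H z + (D - edgeInd (e x cur)) z + edgeInd (e x w₀) z).toNat
  have hG' (z : E) : (G' z : ℤ) = H z + (D - edgeInd (e x cur)) z + edgeInd (e x w₀) z :=
    Int.toNat_of_nonneg (add_nonneg (hlow z).1 (hind z))
  -- Removed edges count positively in `visits`, hence `Δ = -1`.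
  have hshift (z : E) : (G' z : ℤ) = G z + visits e (path ++ [x, w₀]) z * (-1) := by
    rw [hG', h.run.visits_append, h.eq]
    simp only [hD₀, Pi.sub_apply, Pi.add_apply]
    ring
  have hclosed := Closed.close h.run hGx hxF (h.prev_ne hx) hcur hc
  have hdist : ∑ z, |(G' z : ℤ) - H z| < ∑ z, |D₀ z| := by
    have h₁ := sum_abs_add_edgeInd_le (D - edgeInd (e x cur)) (e x w₀)
    rw [sum_abs_sub_edgeInd hx] at h₁
    have h₂ := h.lt hcur.symm
    have h₃ : ∑ z, |(G' z : ℤ) - H z| =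
        ∑ z, |(D - edgeInd (e x cur) + edgeInd (e x w₀)) z| :=
      Finset.sum_congr rfl fun z _ => by rw [hG', Pi.add_apply]; congr 1; ring
    omega
  have hGG' : G ≠ G' := by
    intro h
    rw [← h] at hdist
    exact lt_irrefl _ hdist
  refine ⟨G', mem_graphs_of_closed hG hclosed hshift,
    sampler_ne_zero hGG' hclosed.seqProb_ne_zero hshift ?_
      (finite_admissible hfin hG hclosed fun h => hGG' (funext fun z => ?_)), hdist⟩
  · rw [← classProb_reverse]
    have : Closed e F G' Set.univ (path ++ [x, w₀]).reverse := by
      refine h.run.closed_reverse ?_ hxF (h.prev_ne hx) hcur hc ?_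
      · rintro z ⟨hz, hz'⟩
        have h₁ := (hlow z).2 hz hz'
        have h₂ := hind z
        have h₃ := hG' z
        omega
      · have h₁ := (hlow (e x w₀)).1
        have h₃ := hG' (e x w₀)
        rw [edgeInd_self] at h₃
        omega
    exact fun h => this.seqProb_ne_zero (le_antisymm (h ▸ seqProb_le_classProb _ _) zero_le)
  · have := hshift z
    rw [h] at this
    simpa [eq_comm] using this

theorem Incidence.exists_nStep_sampler_ne_zero (hfin : (I.graphs G₀ F).Finite)
    (hG : G ∈ I.graphs G₀ F) (hH : H ∈ I.graphs G₀ F) :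
    ∃ n, nStep (sampler e F) n G H ≠ 0 := by
  induction hn : (∑ x, |(G x : ℤ) - H x|).toNat using Nat.strong_induction_on generalizing G with
  | _ n ih =>
    by_cases hne : G = H
    · exact ⟨0, by simp [nStep, hne]⟩
    · obtain ⟨G', hG', hpos, hlt⟩ := exists_closer hfin hG hH hne
      have hnn : 0 ≤ ∑ x, |(G' x : ℤ) - H x| := Finset.sum_nonneg fun _ _ => abs_nonneg _
      obtain ⟨m, hm⟩ := ih _ (by omega) hG' rfl
      exact ⟨1 + m, nStep_add_ne_zero (by rwa [nStep_one]) hm⟩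

variable (I)

theorem Incidence.isReversible_and_isErgodicOn {S : Finset (E → ℕ)} (hS : S.Nonempty)
    (h : (S : Set (E → ℕ)) = I.graphs G₀ F) :
    IsReversible (sampler e F) (PMF.uniformOfFinset S hS) ∧
      IsErgodicOn (sampler e F) S (PMF.uniformOfFinset S hS) := by
  have hmem {G : E → ℕ} : G ∈ S ↔ G ∈ I.graphs G₀ F := by rw [← h, Finset.mem_coe]
  have hfin : (I.graphs G₀ F).Finite := h ▸ S.finite_toSet
  have stays : ∀ G ∈ S, (sampler e F G).support ⊆ S := fun G hG => by
    rw [h]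
    exact support_sampler_subset (hmem.1 hG)
  have hrev := isReversible_uniformOfFinset hS stays (sampler_comm e F)
  exact ⟨hrev, isErgodicOn_of_loop stays (by simp) (bind_eq_self_of_isReversible hrev)
    (fun G _ => sampler_self_ne_zero e F G)
    fun G hG H hH => exists_nStep_sampler_ne_zero hfin (hmem.1 hG) (hmem.1 hH)⟩

end Irreducibility

/-! ## Directed and undirected graphs -/

section Instances

variable {V : Type*} [Fintype V]

/-- The strengths of directed graphs. -/
noncomputable def directedIncidence (V : Type*) [Fintype V] :
    Incidence (Prod.mk : V → V → V × V) ((V → ℤ) × (V → ℤ)) where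
  bd :=
    { toFun := fun D => (fun u => ∑ v, D (u, v), fun u => ∑ v, D (v, u))
      map_zero' := by ext <;> simp
      map_add' := fun D D' => by ext <;> simp [Finset.sum_add_distrib] }
  -- The removed and the added edge share their tail, so only in-strengths change.
  vert c := (0, edgeInd c)
  surj x := ⟨x.1, x.2, rfl⟩
  bd_sub a b c := by
    classical
    ext u
    · by_cases hb : b = u <;> simp [edgeInd, hb, -Finset.sum_boole]
    · simp only [AddMonoidHom.coe_mk, ZeroHom.coe_mk, Pi.sub_apply, Finset.sum_sub_distrib,
        Prod.snd_sub]
      by_cases ha : a = u <;> by_cases hc : c = u <;> simp [edgeInd, ha, hc]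
  exists_pos {D a c} hne h := by
    by_contra! hD
    have h₁ : ∑ v, D (v, c) = edgeInd c c - edgeInd a c := congrFun (congrArg Prod.snd h) c
    rw [edgeInd_self, edgeInd_of_ne hne.symm] at h₁
    have h₂ := Finset.sum_nonpos fun v (_ : v ∈ Finset.univ) => hD v
    omega
  exists_neg {D a c} h b := by
    by_contra! hD
    have h₁ : ∑ v, D (b, v) = 0 := by
      have : ∑ v, D (b, v) = (0 : V → ℤ) b - (0 : V → ℤ) b := congrFun (congrArg Prod.fst h) b
      simpa using this
    have h₂ := Finset.sum_nonneg fun v (_ : v ∈ Finset.univ) => hD v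
    have h₃ : ∑ v, edgeInd (b, c) (b, v) = 1 := by
      classical
      simp [edgeInd]
    simp only [Pi.sub_apply, Finset.sum_sub_distrib] at h₂
    omega
  exists_pos_of_neg {D a b} h hb := by
    by_contra! hD
    have h₁ : ∑ v, D (v, a) = 0 := congrFun (congrArg Prod.snd h) a
    have h₂ := Finset.sum_neg' (fun v (_ : v ∈ Finset.univ) => hD v) ⟨b, Finset.mem_univ b, hb⟩
    omega

/-- Strengths of signed weight functions on undirected edges. -/
def signedStrength (V : Type*) [Fintype V] : (Sym2 V → ℤ) →+ (V → ℤ) where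
  toFun D u := (∑ v, D s(u, v)) + D s(u, u)
  map_zero' := by ext; simp
  map_add' D D' := by
    ext
    simp only [Pi.add_apply, Finset.sum_add_distrib]
    ring

theorem signedStrength_apply (D : Sym2 V → ℤ) (u : V) :
    signedStrength V D u = (∑ v, D s(u, v)) + D s(u, u) := rfl

/-- Counting loops twice is what makes this hold for `b = a`. -/
theorem signedStrength_edgeInd (b a : V) :
    signedStrength V (edgeInd s(b, a)) = edgeInd b + edgeInd a := by
  classical
  ext u
  rw [signedStrength_apply, Pi.add_apply]
  by_cases hb : b = u
  · subst hb
    simp only [edgeInd, Sym2.congr_right, Finset.sum_ite_eq, Finset.mem_univ, if_true]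
  · by_cases ha : a = u
    · subst ha
      rw [Sym2.eq_swap]
      simp only [edgeInd, Sym2.congr_right, Finset.sum_ite_eq, Finset.mem_univ, if_true]
      ring
    · simp [edgeInd, ha, hb]

/-- The strengths of undirected graphs. -/
noncomputable def undirectedIncidence (V : Type*) [Fintype V] :
    Incidence (fun u v : V => s(u, v)) (V → ℤ) where
  bd := signedStrength V
  vert := edgeInd
  surj x := by
    induction x using Sym2.ind with
    | _ u v => exact ⟨u, v, rfl⟩
  bd_sub a b c := by
    rw [map_sub, signedStrength_edgeInd, signedStrength_edgeInd]
    abel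
  exists_pos {D a c} hne h := by
    by_contra! hD
    have h₁ := congrFun h c
    rw [signedStrength_apply, Pi.sub_apply, edgeInd_self, edgeInd_of_ne hne.symm] at h₁
    have h₂ := Finset.sum_nonpos fun v (_ : v ∈ Finset.univ) => hD v
    simp only [Sym2.eq_swap (b := c)] at h₂
    have h₃ := hD c
    omega
  exists_neg {D a c} h b := by
    by_contra! hD
    -- The contributions of `c` cancel, even if `b = c`, which leaves `-1 - edgeInd a b < 0` at `b`.
    have h₁ : signedStrength V (D - edgeInd s(b, c)) b =
        (edgeInd c - edgeInd a - (edgeInd b + edgeInd c)) b := by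
      rw [map_sub, h, signedStrength_edgeInd]
    have h₂ := Finset.sum_nonneg fun v (_ : v ∈ Finset.univ) => hD v
    have h₃ := hD b
    have h₄ : 0 ≤ edgeInd a b := by
      unfold edgeInd
      split_ifs <;> simp
    simp only [signedStrength_apply] at h₁
    rw [Pi.sub_apply (edgeInd c - edgeInd a), Pi.sub_apply (edgeInd c), Pi.add_apply,
      edgeInd_self] at h₁
    omega
  exists_pos_of_neg {D a b} h hb := by
    by_contra! hD
    have h₁ := congrFun h a
    rw [signedStrength_apply, Pi.zero_apply] at h₁
    have h₂ := Finset.sum_neg' (fun v (_ : v ∈ Finset.univ) => hD v) ⟨b, Finset.mem_univ b, hb⟩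
    simp only [Sym2.eq_swap (b := a)] at h₂
    have h₃ := hD a
    omega

theorem directedGraphs_eq (G₀ : V × V → ℕ) (F : Set (V × V)) :
    directedGraphs G₀ F = (directedIncidence V).graphs G₀ F := by
  ext G
  have : (directedIncidence V).bd (fun x => (G x : ℤ) - G₀ x) = 0 ↔
      (∀ u, outStrength G u = outStrength G₀ u) ∧ ∀ u, inStrength G u = inStrength G₀ u := by
    simp only [directedIncidence, AddMonoidHom.coe_mk, ZeroHom.coe_mk, Prod.mk_eq_zero,
      funext_iff, Finset.sum_sub_distrib, Pi.zero_apply, sub_eq_zero, outStrength, inStrength]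
    norm_cast
  simp only [directedGraphs, Incidence.graphs, Set.mem_ofPred_eq, this, and_assoc]

theorem undirectedGraphs_eq (G₀ : Sym2 V → ℕ) (F : Set (Sym2 V)) :
    undirectedGraphs G₀ F = (undirectedIncidence V).graphs G₀ F := by
  ext G
  have : (undirectedIncidence V).bd (fun x => (G x : ℤ) - G₀ x) = 0 ↔
      ∀ u, strength G u = strength G₀ u := by
    simp only [undirectedIncidence, funext_iff, signedStrength_apply, Finset.sum_sub_distrib,
      Pi.zero_apply, ← add_sub_add_comm, sub_eq_zero, strength]
    norm_cast
  simp only [undirectedGraphs, Incidence.graphs, Set.mem_ofPred_eq, this]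

end Instances

end WGS

theorem proposition4 {V : Type*} [Fintype V] :
    (∀ (G₀ : V × V → ℕ) (F : Set (V × V)),
      WGS.IsReversible (WGS.sampler Prod.mk F) (WGS.directedUniform G₀ F) ∧
      WGS.IsErgodicOn (WGS.sampler Prod.mk F) (WGS.directedGraphs G₀ F)
        (WGS.directedUniform G₀ F)) ∧
    (∀ (G₀ : Sym2 V → ℕ) (F : Set (Sym2 V)),
      WGS.IsReversible (WGS.sampler (fun u v => s(u, v)) F) (WGS.undirectedUniform G₀ F) ∧
      WGS.IsErgodicOn (WGS.sampler (fun u v => s(u, v)) F) (WGS.undirectedGraphs G₀ F)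
        (WGS.undirectedUniform G₀ F)) := by
  classical
  refine ⟨fun G₀ F => ?_, fun G₀ F => ?_⟩
  · have h := (WGS.directedIncidence V).isReversible_and_isErgodicOn (G₀ := G₀) (F := F)
      (S := (WGS.finite_directedGraphs G₀ F).toFinset) ⟨G₀, by simp [WGS.directedGraphs]⟩
      (by rw [Set.Finite.coe_toFinset, WGS.directedGraphs_eq])
    rwa [Set.Finite.coe_toFinset] at h
  · have h := (WGS.undirectedIncidence V).isReversible_and_isErgodicOn (G₀ := G₀) (F := F)
      (S := (WGS.finite_undirectedGraphs G₀ F).toFinset) ⟨G₀, by simp [WGS.undirectedGraphs]⟩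
      (by rw [Set.Finite.coe_toFinset, WGS.undirectedGraphs_eq])
    rwa [Set.Finite.coe_toFinset] at h
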